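/- Let $X$ be a real Hausdorff topological vector space, $D\subseteq X$ a nonempty convex set, $I\subseteq\mathbb R$ a nonempty interval and $n\in\mathbb N$. Let $D^*$ denote the space of continuous linear functionals on the linear hull of $D-D$ (with the topology inherited from $X$), equipped with the topology of pointwise convergence. A function $E:I\times I\to\mathbb R$ is a deviation if $E(u,u)=0$ for all $u\in I$ and, for every $u\in I$, the function $v\mapsto E(u,v)$ is continuous and strictly decreasing on $I$. For an $m$-tuple $E=(E_1,\dots,E_m)$ of deviations ($m\ge1$) and $x\in I^m$, the deviation mean $\mathscr D^E(x)$ is the unique $y\in I$ with $E_1(x_1,y)+\dots+E_m(x_m,y)=0$. A map $G:D\times D\to D^*$ is a generalized deviation if $G(u,u)=0$ for all $u\in D$ and, for every $u\in D$, the map $v\mapsto G(u,v)$ is continuous on $D$ and satisfies $(G(u,v)-G(u,w))(v-w)<0$ for all $v,w\in D$ with $v\ne w$. For an $m$-tuple $G=(G_1,\dots,G_m)$ of generalized deviations ($m\ge1$) and $x\in D^m$, the generalized deviation mean $\mathscr D^G(x)$ is the unique $y\in\operatorname{conv}\{x_1,\dots,x_m\}$ with $$(G_1(x_1,y)+\dots+G_m(x_m,y))(x_i-y)\le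 0\qquad(i=1,\dots,m).$$ Let $G_1,\dots,G_n$ be generalized deviations on $D$ and $E_1,\dots,E_n$ deviations on $I$, and suppose that $f:D\to I$ satisfies $$f\big(\mathscr D^{G}(x_1,\dots,x_n)\big)\le \mathscr D^{E}\big(f(x_1),\dots,f(x_n)\big)\qquad(x_1,\dots,x_n\in D).$$ Then, for all $k\in\{1,\dots,n\}$ and all injective $\chi:\{1,\dots,k\}\to\{1,\dots,n\}$, writing $G_\chi=(G_{\chi(1)},\dots,G_{\chi(k)})$ and $E_\chi=(E_{\chi(1)},\dots,E_{\chi(k)})$, the means $\mathscr D^{G_\chi}$ and $\mathscr D^{E_\chi}$ are well defined (the required $y$ exists and is unique), and $$f\big(\mathscr D^{G_\chi}(x_1,\dots,x_k)\big)\le \mathscr D^{E_\chi}\big(f(x_1),\dots,f(x_k)\big)\qquad(x_1,\dots,x_k\in D).$$ -/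

import Mathlib

open scoped Pointwise

noncomputable section

/-- A real function `E` on `I × I` is a deviation on `I`: it vanishes on the diagonal, and it is
continuous and strictly decreasing in its second variable. -/
structure IsDeviation {I : Set ℝ} (E : I → I → ℝ) : Prop where
  diag : ∀ u : I, E u u = 0
  continuous : ∀ u : I, Continuous (E u)
  strictAnti : ∀ u : I, StrictAnti (E u)

/-- `y ∈ I` solves `E₁(x₁,y) + ⋯ + Eₙ(xₙ,y) = 0`. -/
def IsDeviationMean {I : Set ℝ} {n : ℕ} (E : Fin n → I → I → ℝ) (x : Fin n → I) (y : I) : Prop :=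
  ∑ i, E i (x i) y = 0

/-- The deviation mean of `x`: the point `y ∈ I` satisfying `IsDeviationMean E x y`. -/
def deviationMean {I : Set ℝ} [Nonempty I] {n : ℕ} (E : Fin n → I → I → ℝ) (x : Fin n → I) : I :=
  Classical.epsilon fun y => IsDeviationMean E x y

section GeneralizedDeviations

variable {X : Type*} [AddCommGroup X] [Module ℝ X]

/-- The linear hull of the difference set `D - D`. -/
abbrev diffSpan (D : Set X) : Submodule ℝ X := Submodule.span ℝ (D - D)

/-- The difference `u - v` of two points of `D`, as a vector of the linear hull of `D - D`. -/
def diffVec {D : Set X} (u v : D) : diffSpan D :=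
  ⟨(u : X) - (v : X), Submodule.subset_span (Set.sub_mem_sub u.2 v.2)⟩

variable [TopologicalSpace X]

/-- The space `D^*` of continuous linear functionals on the linear hull of `D - D`, the latter with
the topology inherited from `X`. It carries the topology of pointwise convergence: continuity into
`D^*` in any finer dual topology (e.g. the norm topology, for normed `X`) implies continuity in this
one, so that the notion of generalized deviation below is the most inclusive one. -/
abbrev DiffDual (D : Set X) : Type _ := WeakDual ℝ (diffSpan D)

/-- A map `E : D × D → D^*` is a generalized deviation on `D`: it vanishes on the diagonal, and, in
its second variable, it is continuous with `-E(u, ·)` strictly monotone. -/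
structure IsGenDeviation {D : Set X} (E : D → D → DiffDual D) : Prop where
  diag : ∀ u : D, E u u = 0
  continuous : ∀ u : D, Continuous fun v : D => -E u v
  strictMono : ∀ u v w : D, v ≠ w → (E u v - E u w) (diffVec v w) < 0

/-- `y ∈ conv {x₁, …, xₙ}` and `(E₁(x₁,y) + ⋯ + Eₙ(xₙ,y)) (xᵢ - y) ≤ 0` for all `i`. -/
def IsGenDeviationMean {D : Set X} {n : ℕ} (E : Fin n → D → D → DiffDual D) (x : Fin n → D)
    (y : D) : Prop :=
  (y : X) ∈ convexHull ℝ (Set.range fun i => (x i : X)) ∧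
    ∀ i, (∑ j, E j (x j) y) (diffVec (x i) y) ≤ 0

/-- The generalized deviation mean of `x`: the point `y` satisfying `IsGenDeviationMean E x y`. -/
def genDeviationMean {D : Set X} [Nonempty D] {n : ℕ} (E : Fin n → D → D → DiffDual D)
    (x : Fin n → D) : D :=
  Classical.epsilon fun y => IsGenDeviationMean E x y

end GeneralizedDeviations

end

/-!
Both means exist and are unique. For the deviation mean this is the intermediate value theorem
applied to the strictly decreasing function `y ↦ ∑ i, E i (x i) y`
(`existsUnique_isDeviationMean`). The generalized deviation mean is the solution `y` of the
variational inequality `0 ≤ F y (v - y)`, `v ∈ K`, where `F = -∑ j, G j (x j)` is continuous and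
strictly monotone and `K` is the convex hull of the `x i`. Monotonicity makes a fixed point theorem
unnecessary here: by Minty's argument it is enough to find `y ∈ K` with `0 ≤ F v (v - y)` for all
`v ∈ K` (`variational_inequality_of_minty`); these are closed conditions on a point of a compact
set, so it suffices to satisfy finitely many at once, and for points `v i` the matrix
`A i j = F (v i) (v i - v j)` has nonnegative symmetric part, so that separating the image of the
simplex from the nonnegative orthant gives the weights of a solution
(`exists_stdSimplex_sum_nonneg`). Strict monotonicity yields uniqueness.

For the inequality, let `y` be the generalized deviation mean of the `k`-tuple `x`, and extend `x`
to an `n`-tuple by the value `y` outside the range of `χ`. As `G j y y = 0`, the point `y` is also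
the generalized deviation mean of the extended tuple (`IsGenDeviationMean.extend`), so `f y ≤ z`,
where `z` is the deviation mean of the extension of `f ∘ x` by `f y`. If the deviation mean of
`f ∘ x` were smaller than `f y`, then `∑ i, E (χ i) (f (x i)) z < 0`, while all other terms
`E j (f y) z` are nonpositive; this contradicts the equation that defines `z`
(`IsDeviationMean.le_of_extend`).
-/

/-! ### A matrix with nonnegative symmetric part -/

/-- The theorem of the alternative behind the existence of generalized deviation means: if the
symmetric part of `A` has nonnegative entries, then `A` maps a point of the standard simplex into
the nonnegative orthant. -/
theorem exists_stdSimplex_sum_nonneg {ι : Type*} [Fintype ι] [Nonempty ι] (A : ι → ι → ℝ)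
    (hA : ∀ i j, 0 ≤ A i j + A j i) :
    ∃ w ∈ stdSimplex ℝ ι, ∀ i, 0 ≤ ∑ j, w j * A i j := by
  classical
  by_contra! hcon
  let L : (ι → ℝ) →ₗ[ℝ] (ι → ℝ) := Matrix.mulVecLin (Matrix.of A)
  have hL : ∀ w i, L w i = ∑ j, w j * A i j := fun w i => by
    simp [L, Matrix.mulVec, dotProduct, mul_comm]
  have hdisj : Disjoint (L '' stdSimplex ℝ ι) (Set.Ici 0) := by
    rw [Set.disjoint_left]
    rintro _ ⟨w, hw, rfl⟩ hpos
    obtain ⟨i, hi⟩ := hcon w hw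
    have := hpos i
    rw [hL] at this
    exact absurd this (not_le.2 hi)
  obtain ⟨g, a, b, hga, hab, hgb⟩ := geometric_hahn_banach_compact_closed
    ((convex_stdSimplex ℝ ι).linear_image L)
    ((isCompact_stdSimplex ℝ ι).image L.continuous_of_finiteDimensional)
    (convex_Ici (0 : ι → ℝ)) isClosed_Ici hdisj
  have hb : b < 0 := by simpa using hgb 0 (Set.mem_Ici.2 le_rfl)
  -- `m` is the coefficient vector of the separating functional.
  let m : ι → ℝ := fun i => g (Pi.single i 1)
  have hg : ∀ v, g v = ∑ i, v i * m i := fun v => by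
    conv_lhs => rw [pi_eq_sum_univ' v]
    simp only [map_sum, map_smul, smul_eq_mul, m]
  have hm : ∀ i, 0 ≤ m i := by
    intro i
    by_contra! hi
    -- The ray spanned by the `i`-th unit vector would leave the half-space.
    have h := hgb ((b / m i) • Pi.single i 1)
      (Set.mem_Ici.2 (smul_nonneg (div_nonneg_of_nonpos hb.le hi.le)
        (Pi.single_nonneg.2 zero_le_one)))
    rw [map_smul, smul_eq_mul, div_mul_cancel₀ _ hi.ne] at h
    exact lt_irrefl _ h
  have hcol : ∀ j, ∑ i, A i j * m i < 0 := by
    intro j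
    have h := hga _ ⟨_, single_mem_stdSimplex ℝ j, rfl⟩
    rw [hg] at h
    simp only [hL, Pi.single_apply, ite_mul, one_mul, zero_mul, Finset.sum_ite_eq',
      Finset.mem_univ, if_true] at h
    linarith
  obtain ⟨j, hj⟩ : ∃ j, 0 < m j := by
    by_contra! h
    have hm0 : ∀ i, m i = 0 := fun i => le_antisymm (h i) (hm i)
    have := hcol (Classical.arbitrary ι)
    simp [hm0] at this
  have hneg : ∑ j, (∑ i, A i j * m i) * m j < 0 :=
    Finset.sum_neg' (fun j _ => mul_nonpos_of_nonpos_of_nonneg (hcol j).le (hm j))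
      ⟨j, Finset.mem_univ j, mul_neg_of_neg_of_pos (hcol j) hj⟩
  -- The left-hand side of `hneg` is the quadratic form of `A` at `m`, which depends only on the
  -- symmetric part of `A` and is therefore nonnegative.
  have hswap : ∑ j, (∑ i, A i j * m i) * m j = ∑ j, (∑ i, A j i * m i) * m j := by
    simp only [Finset.sum_mul]
    rw [Finset.sum_comm]
    exact Finset.sum_congr rfl fun i _ => Finset.sum_congr rfl fun j _ => by ring
  have hsum : 0 ≤ ∑ j, (∑ i, A i j * m i) * m j + ∑ j, (∑ i, A j i * m i) * m j := by
    simp only [Finset.sum_mul, ← Finset.sum_add_distrib]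
    refine Finset.sum_nonneg fun j _ => Finset.sum_nonneg fun i _ => ?_
    have := mul_nonneg (mul_nonneg (hA i j) (hm i)) (hm j)
    linarith
  linarith

/-! ### Deviation means -/

section Deviation

variable {I : Set ℝ} {n : ℕ} {E : Fin n → I → I → ℝ}

theorem strictAnti_sum_deviation (hn : 1 ≤ n) (hE : ∀ i, IsDeviation (E i)) (x : Fin n → I) :
    StrictAnti fun y => ∑ i, E i (x i) y := by
  intro y z hyz
  have : NeZero n := ⟨by omega⟩
  exact Finset.sum_lt_sum_of_nonempty Finset.univ_nonempty
    fun i _ => (hE i).strictAnti (x i) hyz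

theorem existsUnique_isDeviationMean (hI : I.OrdConnected) (hn : 1 ≤ n)
    (hE : ∀ i, IsDeviation (E i)) (x : Fin n → I) : ∃! z, IsDeviationMean E x z := by
  have : NeZero n := ⟨by omega⟩
  have : PreconnectedSpace I := Subtype.preconnectedSpace hI.isPreconnected
  obtain ⟨a, ha⟩ := Finite.exists_min x
  obtain ⟨b, hb⟩ := Finite.exists_max x
  have hcont : Continuous fun y => ∑ i, E i (x i) y :=
    continuous_finsetSum _ fun i _ => (hE i).continuous (x i)
  have h0a : 0 ≤ ∑ i, E i (x i) (x a) := Finset.sum_nonneg fun i _ => by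
    simpa only [(hE i).diag] using ((hE i).strictAnti (x i)).antitone (ha i)
  have hb0 : ∑ i, E i (x i) (x b) ≤ 0 := Finset.sum_nonpos fun i _ => by
    simpa only [(hE i).diag] using ((hE i).strictAnti (x i)).antitone (hb i)
  obtain ⟨z, hz⟩ := mem_range_of_exists_le_of_exists_ge hcont ⟨_, hb0⟩ ⟨_, h0a⟩
  exact ⟨z, hz, fun w hw =>
    (strictAnti_sum_deviation hn hE x).injective (Eq.trans hw hz.symm)⟩

theorem isDeviationMean_deviationMean [Nonempty I] (hI : I.OrdConnected) (hn : 1 ≤ n)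
    (hE : ∀ i, IsDeviation (E i)) (x : Fin n → I) :
    IsDeviationMean E x (deviationMean E x) :=
  Classical.epsilon_spec (existsUnique_isDeviationMean hI hn hE x).exists

/-- If the deviation mean `z` of the extension of `x` by the constant `u` is at least `u`, then so
is the deviation mean of `x` itself. -/
theorem IsDeviationMean.le_of_extend (hE : ∀ i, IsDeviation (E i)) {k : ℕ} (hk : 1 ≤ k)
    {χ : Fin k → Fin n} (hχ : Function.Injective χ) {x : Fin k → I} {u w z : I}
    (hw : IsDeviationMean (E ∘ χ) x w)
    (hz : IsDeviationMean E (Function.extend χ x fun _ => u) z) (huz : u ≤ z) : u ≤ w := by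
  classical
  by_contra! hwu
  have hlt : ∑ i, (E ∘ χ) i (x i) z < 0 := by
    rw [← show ∑ i, (E ∘ χ) i (x i) w = 0 from hw]
    exact strictAnti_sum_deviation hk (fun i => hE (χ i)) x (hwu.trans_le huz)
  have hle : ∑ j, E j (Function.extend χ x (fun _ => u) j) z ≤ ∑ i, (E ∘ χ) i (x i) z := by
    rw [← Finset.sum_add_sum_compl (Finset.univ.image χ),
      Finset.sum_image fun _ _ _ _ h => hχ h]
    simp only [hχ.extend_apply, Function.comp_apply]
    refine add_le_of_nonpos_right (Finset.sum_nonpos fun j hj => ?_)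
    rw [Function.extend_apply' _ _ _ (by simpa using hj)]
    simpa only [(hE j).diag] using ((hE j).strictAnti u).antitone huz
  exact (hle.trans_lt hlt).ne hz

end Deviation

/-! ### Monotone variational inequalities -/

section Variational

variable {X : Type*} [AddCommGroup X] [Module ℝ X] [TopologicalSpace X] {D : Set X}

theorem continuous_diffVec_right [IsTopologicalAddGroup X] (u : D) :
    Continuous fun v : D => diffVec u v :=
  Continuous.subtype_mk (continuous_const.sub continuous_subtype_val) _

omit [TopologicalSpace X] in
theorem neg_diffVec (u v : D) : -diffVec u v = diffVec v u :=
  Subtype.ext (neg_sub _ _)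

omit [TopologicalSpace X] in
theorem diffVec_self (u : D) : diffVec u u = 0 :=
  Subtype.ext (sub_self _)

theorem apply_diffVec_add_apply_diffVec (φ ψ : DiffDual D) (v w : D) :
    φ (diffVec v w) + ψ (diffVec w v) = (φ - ψ) (diffVec v w) := by
  rw [← neg_diffVec v w, map_neg, ← sub_eq_add_neg]
  rfl

variable {F : D → DiffDual D} {K : Set X}

/-- Minty's inequality `0 ≤ F v (v - y)` for a monotone `F` can be satisfied by one `y ∈ K` for all
`v ∈ K` simultaneously. -/
theorem exists_minty [IsTopologicalAddGroup X]
    (hmono : ∀ v w, 0 ≤ (F v - F w) (diffVec v w)) (hK : IsCompact K) (hKc : Convex ℝ K)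
    (hne : K.Nonempty) (hKD : K ⊆ D) :
    ∃ y : D, (y : X) ∈ K ∧ ∀ v : D, (v : X) ∈ K → 0 ≤ F v (diffVec v y) := by
  have : CompactSpace K := isCompact_iff_compactSpace.1 hK
  have : Nonempty K := hne.to_subtype
  let e : K → D := Set.inclusion hKD
  have he : Continuous e := continuous_inclusion hKD
  let t : K → Set K := fun v => {y | 0 ≤ F (e v) (diffVec (e v) (e y))}
  have hclosed : ∀ v, IsClosed (t v) := fun v =>
    isClosed_le continuous_const
      ((F (e v)).continuous.comp ((continuous_diffVec_right (e v)).comp he))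
  have hfin : ∀ s : Finset K, (⋂ v ∈ s, t v).Nonempty := by
    intro s
    rcases s.eq_empty_or_nonempty with rfl | hs
    · simp
    have : Nonempty s := hs.to_subtype
    -- Monotonicity of `F` makes the symmetric part of this matrix nonnegative, and the weights `w`
    -- turn into the convex combination of the points of `s` that lies in every `t v`.
    obtain ⟨w, hw, hpos⟩ := exists_stdSimplex_sum_nonneg
      (fun i j : s => F (e i) (diffVec (e i) (e j))) fun i j => by
        rw [apply_diffVec_add_apply_diffVec]
        exact hmono _ _
    refine ⟨⟨∑ j : s, w j • (j : X), hKc.sum_mem (fun j _ => hw.1 j) hw.2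
      fun j _ => j.1.2⟩, Set.mem_iInter₂.2 fun v hv => ?_⟩
    have hdiff : diffVec (e v) (e ⟨∑ j : s, w j • (j : X), hKc.sum_mem (fun j _ => hw.1 j) hw.2
        fun j _ => j.1.2⟩) = ∑ j : s, w j • diffVec (e v) (e j) := by
      refine Subtype.ext ?_
      simp only [diffVec, Submodule.coe_sum, Submodule.coe_smul, smul_sub,
        Finset.sum_sub_distrib, ← Finset.sum_smul, hw.2, one_smul]
      rfl
    have h := hpos ⟨v, hv⟩
    simp only [t, Set.mem_ofPred_eq, hdiff, map_sum, map_smul, smul_eq_mul]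
    exact h
  obtain ⟨y, hy⟩ := CompactSpace.iInter_nonempty hclosed hfin
  exact ⟨e y, y.2, fun v hv => Set.mem_iInter.1 hy ⟨v, hv⟩⟩

/-- Minty's lemma: for a continuous `F`, Minty's inequality implies the variational inequality. -/
theorem variational_inequality_of_minty [IsTopologicalAddGroup X] [ContinuousSMul ℝ X]
    (hF : Continuous F) (hKc : Convex ℝ K) (hKD : K ⊆ D) {y : D} (hy : (y : X) ∈ K)
    (h : ∀ v : D, (v : X) ∈ K → 0 ≤ F v (diffVec v y)) (v : D) (hv : (v : X) ∈ K) :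
    0 ≤ F y (diffVec v y) := by
  have hmem : ∀ t : unitInterval, AffineMap.lineMap (y : X) (v : X) (t : ℝ) ∈ K :=
    fun t => hKc.lineMap_mem hy hv t.2
  let c : unitInterval → D := fun t => ⟨AffineMap.lineMap (y : X) (v : X) (t : ℝ), hKD (hmem t)⟩
  have hc : Continuous c := by
    refine Continuous.subtype_mk ?_ _
    simp only [AffineMap.lineMap_apply, vsub_eq_sub, vadd_eq_add]
    fun_prop
  have hc0 : c 0 = y := Subtype.ext (by simp [c])
  have hφ : Continuous fun t => F (c t) (diffVec v y) :=
    (WeakDual.eval_continuous _).comp (hF.comp hc)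
  -- `F (c t) (v - y)` is nonnegative for `t > 0`; pass to the limit `t → 0`.
  have hpos : ∀ t : unitInterval, 0 < t → 0 ≤ F (c t) (diffVec v y) := by
    intro t ht
    have hd : diffVec (c t) y = (t : ℝ) • diffVec v y := Subtype.ext (by
      simp [diffVec, c, AffineMap.lineMap_apply])
    have := h (c t) (hmem t)
    rw [hd, map_smul, smul_eq_mul] at this
    exact nonneg_of_mul_nonneg_right this ht
  have hcl : (0 : unitInterval) ∈ closure (Set.Ioi 0) := by
    rw [closure_Ioi' ⟨1, zero_lt_one⟩]
    exact Set.mem_Ici.2 le_rfl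
  have hlim : 0 ≤ F (c 0) (diffVec v y) :=
    closure_minimal (s := Set.Ioi 0) (t := {t | 0 ≤ F (c t) (diffVec v y)})
      (fun t ht => hpos t ht) (isClosed_le continuous_const hφ) hcl
  rwa [hc0] at hlim

end Variational

/-! ### Generalized deviation means -/

section GenDeviation

variable {X : Type*} [AddCommGroup X] [Module ℝ X] [TopologicalSpace X] {D : Set X} {n : ℕ}
  {G : Fin n → D → D → DiffDual D}

theorem sum_genDeviation_sub_apply_neg (hn : 1 ≤ n) (hG : ∀ i, IsGenDeviation (G i))
    (x : Fin n → D) {v w : D} (hvw : v ≠ w) :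
    (∑ j, G j (x j) v - ∑ j, G j (x j) w) (diffVec v w) < 0 := by
  have : NeZero n := ⟨by omega⟩
  rw [← Finset.sum_sub_distrib]
  have h : (∑ j, (G j (x j) v - G j (x j) w)) (diffVec v w)
      = ∑ j, (G j (x j) v - G j (x j) w) (diffVec v w) :=
    sum_apply (F := StrongDual ℝ (diffSpan D)) _ _ _
  rw [h]
  exact Finset.sum_neg (fun j _ => (hG j).strictMono (x j) v w hvw) Finset.univ_nonempty

/-- The inequalities at the points `x i` extend to their convex hull. -/
theorem IsGenDeviationMean.apply_diffVec_nonpos (hD : Convex ℝ D) {x : Fin n → D} {y : D}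
    (hy : IsGenDeviationMean G x y) {v : D}
    (hv : (v : X) ∈ convexHull ℝ (Set.range fun i => (x i : X))) :
    (∑ j, G j (x j) y) (diffVec v y) ≤ 0 := by
  let s : Set X := {p | ∃ h : p ∈ D, (∑ j, G j (x j) y) (diffVec ⟨p, h⟩ y) ≤ 0}
  have hs : Convex ℝ s := by
    rintro p ⟨hp, hp0⟩ q ⟨hq, hq0⟩ a b ha hb hab
    refine ⟨hD hp hq ha hb hab, ?_⟩
    have hdiff : diffVec ⟨a • p + b • q, hD hp hq ha hb hab⟩ y
        = a • diffVec ⟨p, hp⟩ y + b • diffVec ⟨q, hq⟩ y := by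
      refine Subtype.ext ?_
      change a • p + b • q - (y : X) = a • (p - (y : X)) + b • (q - (y : X))
      conv_lhs => rw [← one_smul ℝ (y : X), ← hab]
      module
    rw [hdiff, map_add, map_smul, map_smul]
    exact add_nonpos (mul_nonpos_of_nonneg_of_nonpos ha hp0)
      (mul_nonpos_of_nonneg_of_nonpos hb hq0)
  obtain ⟨_, h⟩ := convexHull_min (t := s)
    (Set.range_subset_iff.2 fun i => ⟨(x i).2, hy.2 i⟩) hs hv
  exact h

theorem existsUnique_isGenDeviationMean [IsTopologicalAddGroup X] [ContinuousSMul ℝ X]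
    (hD : Convex ℝ D) (hn : 1 ≤ n) (hG : ∀ i, IsGenDeviation (G i)) (x : Fin n → D) :
    ∃! y, IsGenDeviationMean G x y := by
  have : NeZero n := ⟨by omega⟩
  let S : D → DiffDual D := fun y => ∑ j, G j (x j) y
  let K : Set X := convexHull ℝ (Set.range fun i => (x i : X))
  have hxK : ∀ i, (x i : X) ∈ K := fun i => subset_convexHull ℝ _ ⟨i, rfl⟩
  have hKD : K ⊆ D := convexHull_min (Set.range_subset_iff.2 fun i => (x i).2) hD
  have hKc : Convex ℝ K := convex_convexHull ℝ _
  have hS : Continuous fun v => -S v := by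
    simp only [S, ← Finset.sum_neg_distrib]
    exact continuous_finsetSum _ fun j _ => (hG j).continuous (x j)
  have hmono : ∀ v w, 0 ≤ (-S v - -S w) (diffVec v w) := by
    intro v w
    rcases eq_or_ne v w with rfl | hvw
    · rw [sub_self]
      exact le_rfl
    · have h := sum_genDeviation_sub_apply_neg hn hG x hvw
      rw [neg_sub_neg, ← neg_sub]
      exact (neg_pos.2 h).le
  obtain ⟨y, hyK, hy⟩ := exists_minty hmono ((Set.finite_range _).isCompact_convexHull ℝ) hKc
    ⟨_, hxK 0⟩ hKD
  have hy' : IsGenDeviationMean G x y := ⟨hyK, fun i => neg_nonneg.1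
    (variational_inequality_of_minty hS hKc hKD hyK hy (x i) (hxK i))⟩
  refine ⟨y, hy', fun z hz => ?_⟩
  -- For two solutions, adding the inequality of each at the other contradicts strict monotonicity.
  by_contra hzy
  have hneg := sum_genDeviation_sub_apply_neg hn hG x (Ne.symm hzy)
  have h₁ := hy'.apply_diffVec_nonpos hD hz.1
  have h₂ := hz.apply_diffVec_nonpos hD hy'.1
  rw [← apply_diffVec_add_apply_diffVec] at hneg
  rw [← neg_diffVec y z, map_neg] at h₁
  rw [← neg_diffVec z y, map_neg] at h₂
  linarith

theorem isGenDeviationMean_genDeviationMean [IsTopologicalAddGroup X] [ContinuousSMul ℝ X]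
    [Nonempty D] (hD : Convex ℝ D) (hn : 1 ≤ n) (hG : ∀ i, IsGenDeviation (G i))
    (x : Fin n → D) : IsGenDeviationMean G x (genDeviationMean G x) :=
  Classical.epsilon_spec (existsUnique_isGenDeviationMean hD hn hG x).exists

/-- Filling up a tuple with copies of its generalized deviation mean does not change the mean. -/
theorem IsGenDeviationMean.extend (hG : ∀ i, IsGenDeviation (G i)) {k : ℕ}
    {χ : Fin k → Fin n} (hχ : Function.Injective χ) {x : Fin k → D} {y : D}
    (hy : IsGenDeviationMean (G ∘ χ) x y) :
    IsGenDeviationMean G (Function.extend χ x fun _ => y) y := by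
  have hsum : ∑ j, G j (Function.extend χ x (fun _ => y) j) y = ∑ i, (G ∘ χ) i (x i) y := by
    refine (Fintype.sum_of_injective χ hχ _ _ (fun j hj => ?_) fun i => ?_).symm
    · rw [Function.extend_apply' _ _ _ hj, (hG j).diag]
    · rw [hχ.extend_apply, Function.comp_apply]
  refine ⟨convexHull_mono (Set.range_subset_iff.2 fun i => Set.mem_range.2 ⟨χ i, ?_⟩) hy.1,
    fun j => ?_⟩
  · rw [hχ.extend_apply]
  · rw [hsum]
    by_cases hj : ∃ i, χ i = j
    · obtain ⟨i, rfl⟩ := hj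
      rw [hχ.extend_apply]
      exact hy.2 i
    · rw [Function.extend_apply' _ _ _ hj, diffVec_self, map_zero]

end GenDeviation

/-! ### The inequality for subfamilies -/

theorem mainTheorem7 {X : Type*} [AddCommGroup X] [Module ℝ X] [TopologicalSpace X]
    [IsTopologicalAddGroup X] [ContinuousSMul ℝ X] [T2Space X]
    (D : Set X) [Nonempty D] (hD : Convex ℝ D)
    (I : Set ℝ) [Nonempty I] (hI : I.OrdConnected)
    (n : ℕ)
    (G : Fin n → D → D → DiffDual D) (hG : ∀ i, IsGenDeviation (G i))
    (E : Fin n → I → I → ℝ) (hE : ∀ i, IsDeviation (E i))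
    (f : D → I)
    (hf : ∀ x : Fin n → D, f (genDeviationMean G x) ≤ deviationMean E (f ∘ x))
    (k : ℕ) (hk : 1 ≤ k) (hkn : k ≤ n)
    (χ : Fin k → Fin n) (hχ : Function.Injective χ) (x : Fin k → D) :
    -- both means are well defined
    (∃! y : D, IsGenDeviationMean (G ∘ χ) x y) ∧
    (∃! z : I, IsDeviationMean (E ∘ χ) (f ∘ x) z) ∧
    f (genDeviationMean (G ∘ χ) x) ≤ deviationMean (E ∘ χ) (f ∘ x) := by
  have hn : 1 ≤ n := hk.trans hkn
  have hGχ : ∀ i, IsGenDeviation ((G ∘ χ) i) := fun i => hG (χ i)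
  have hEχ : ∀ i, IsDeviation ((E ∘ χ) i) := fun i => hE (χ i)
  refine ⟨existsUnique_isGenDeviationMean hD hk hGχ x,
    existsUnique_isDeviationMean hI hk hEχ (f ∘ x), ?_⟩
  set y := genDeviationMean (G ∘ χ) x
  have hy : IsGenDeviationMean (G ∘ χ) x y := isGenDeviationMean_genDeviationMean hD hk hGχ x
  have hext : genDeviationMean G (Function.extend χ x fun _ => y) = y :=
    (existsUnique_isGenDeviationMean hD hn hG _).unique
      (isGenDeviationMean_genDeviationMean hD hn hG _) (hy.extend hG hχ)
  have hcomp : f ∘ Function.extend χ x (fun _ => y) = Function.extend χ (f ∘ x) fun _ => f y :=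
    funext (Function.apply_extend f χ fun _ => y)
  have hle := hf (Function.extend χ x fun _ => y)
  rw [hext, hcomp] at hle
  exact IsDeviationMean.le_of_extend hE hk hχ (isDeviationMean_deviationMean hI hk hEχ (f ∘ x))
    (isDeviationMean_deviationMean hI hn hE _) hle
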